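/- Let $A,B$ be finite-dimensional quantum systems with fixed bases, and let $\rho$ be a density matrix on $AB$. Put $\langle X,Y\rangle=\mathrm{Tr}(X^\dagger Y)$, let $X^{T_B}$ be the partial transpose on the second system, let $\|\cdot\|_1$ be the trace norm, and let $\mathcal R(A|B)=\{X\succeq 0:\ \|X^{T_B}\|_1\le 1\}$ be the Rains set. A completely positive trace-preserving linear map $\Lambda:AB\to A'B'$ is called Rains-preserving if $\Lambda(X)\in\mathcal R(A'|B')$ for every $X\in\mathcal R(A|B)$. For $m\in\mathbb N$, $m\ge 1$, let $\Psi_m$ be the projector onto $m^{-1/2}\sum_{i=1}^m|ii\rangle$ in $\mathbb C^m\otimes\mathbb C^m$ and define $$F(\rho,m)=\sup\{\langle\Lambda(\rho),\Psi_m\rangle:\ \Lambda \text{ Rains-preserving with } d_{A'}=d_{B'}=m\},$$ $$G^{(m)}_{\mathcal R}(\rho)=\sup\{\langle\rho,W\rangle:\ 0\preceq W\preceq \mathbb 1,\ W\in\tfrac1m\mathcal R(A|B)^\circ\},$$ where $\mathcal Q^\circ=\{X \text{ Hermitian}:\langle X,Z\rangle\le1\ \forall Z\in \mathcal Q\}$.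 For $0\le\varepsilon<1$ let $$E^{(1),\varepsilon}_d(\rho)=\log_2\max\{m\ge1:\ F(\rho,m)\ge1-\varepsilon\},$$ $$D_H^\varepsilon(\rho\|X)=-\log_2\min\{\langle M,X\rangle:\ 0\preceq M\preceq\mathbb 1,\ 1-\langle M,\rho\rangle\le\varepsilon\},$$ with $\log_2x=-\infty$ for $x\le0$, and $\lfloor x\rfloor_{\log}=\log_2\lfloor2^x\rfloor$. Theorem. For every integer $m\ge1$ both suprema above are finite and $$F(\rho,m)=G^{(m)}_{\mathcal R}(\rho).$$ For every $0\le\varepsilon<1$, the maximum defining $E^{(1),\varepsilon}_d(\rho)$ exists, the minimum $\min_{X\in\mathcal R(A|B)}D_H^\varepsilon(\rho\|X)$ is attained and finite, and $$E^{(1),\varepsilon}_d(\rho)=\Big\lfloor\min_{X\in\mathcal R(A|B)}D_H^\varepsilon(\rho\|X)\Big\rfloor_{\log}.$$ -/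

import Mathlib

open scoped Pointwise ComplexOrder Matrix

namespace RainsDistillation

noncomputable section

/-- Hilbert–Schmidt inner product `⟨X, Y⟩ = Tr (X† Y)`; it is real on Hermitian matrices, which
is where it is used, so the real part is taken. -/
def hsInner {n : Type*} [Fintype n] (X Y : Matrix n n ℂ) : ℝ :=
  ((Xᴴ * Y).trace).re

/-- Density matrices. -/
def IsState {n : Type*} [Fintype n] (ρ : Matrix n n ℂ) : Prop :=
  ρ.PosSemidef ∧ ρ.trace = 1

/-- Operators `M` with `0 ⪯ M ⪯ 1`. -/
def IsEffect {n : Type*} [DecidableEq n] (M : Matrix n n ℂ) : Prop :=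
  M.PosSemidef ∧ (1 - M).PosSemidef

/-- Schatten 1-norm `Tr |X|`, with `|X| = (X† X)^{1/2}`: the sum of the singular values of `X`. -/
def traceNorm {n : Type*} [Fintype n] [DecidableEq n] (X : Matrix n n ℂ) : ℝ :=
  ∑ i, Real.sqrt ((Matrix.isHermitian_conjTranspose_mul_self X).eigenvalues i)

/-- Partial transpose on the second subsystem. -/
def partialTranspose {A B : Type*} (X : Matrix (A × B) (A × B) ℂ) : Matrix (A × B) (A × B) ℂ :=
  Matrix.of fun p q => X (p.1, q.2) (q.1, p.2)

/-- The Rains set `{X ⪰ 0 : ‖X^{T_B}‖₁ ≤ 1}`. -/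
def rainsSet (A B : Type*) [Fintype A] [Fintype B] [DecidableEq A] [DecidableEq B] :
    Set (Matrix (A × B) (A × B) ℂ) :=
  {X | X.PosSemidef ∧ traceNorm (partialTranspose X) ≤ 1}

/-- The ampliation `id_k ⊗ Λ`, applying `Λ` to each block of a `k × k` block matrix. -/
def ampliation {n p : Type*} (k : ℕ) (Λ : Matrix n n ℂ →ₗ[ℂ] Matrix p p ℂ)
    (M : Matrix (Fin k × n) (Fin k × n) ℂ) : Matrix (Fin k × p) (Fin k × p) ℂ :=
  Matrix.of fun x y => Λ (Matrix.of fun a b => M (x.1, a) (y.1, b)) x.2 y.2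

/-- Complete positivity: every `id_k ⊗ Λ` is a positive map. -/
def IsCompletelyPositive {n p : Type*}
    (Λ : Matrix n n ℂ →ₗ[ℂ] Matrix p p ℂ) : Prop :=
  ∀ (k : ℕ) (M : Matrix (Fin k × n) (Fin k × n) ℂ), M.PosSemidef → (ampliation k Λ M).PosSemidef

/-- Completely positive trace-preserving maps. -/
def IsCPTP {n p : Type*} [Fintype n] [Fintype p]
    (Λ : Matrix n n ℂ →ₗ[ℂ] Matrix p p ℂ) : Prop :=
  IsCompletelyPositive Λ ∧ ∀ X, (Λ X).trace = X.trace

/-- The class of Rains-preserving operations `AB → A'B'`. -/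
def rainsPreserving (A B A' B' : Type*) [Fintype A] [Fintype B] [DecidableEq A] [DecidableEq B]
    [Fintype A'] [Fintype B'] [DecidableEq A'] [DecidableEq B'] :
    Set (Matrix (A × B) (A × B) ℂ →ₗ[ℂ] Matrix (A' × B') (A' × B') ℂ) :=
  {Λ | IsCPTP Λ ∧ ∀ X ∈ rainsSet A B, Λ X ∈ rainsSet A' B'}

/-- The unit vector `|Ψ_m⟩ = m^{-1/2} ∑ᵢ |ii⟩`. -/
def maxEntangledKet (m : ℕ) : Fin m × Fin m → ℂ :=
  fun p => if p.1 = p.2 then (((1 / Real.sqrt m : ℝ)) : ℂ) else 0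

/-- The projector `Ψ_m = |Ψ_m⟩⟨Ψ_m|`. -/
def maxEntangled (m : ℕ) : Matrix (Fin m × Fin m) (Fin m × Fin m) ℂ :=
  Matrix.vecMulVec (maxEntangledKet m) (star (maxEntangledKet m))

section Distillation

variable {A B : Type*} [Fintype A] [Fintype B] [DecidableEq A] [DecidableEq B]

/-- The values `⟨Λ(ρ), Ψ_m⟩` achieved by Rains-preserving operations. -/
def achievableFidelities (ρ : Matrix (A × B) (A × B) ℂ) (m : ℕ) : Set ℝ :=
  {f | ∃ Λ ∈ rainsPreserving A B (Fin m) (Fin m), f = hsInner (Λ ρ) (maxEntangled m)}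

/-- The fidelity of distillation `F(ρ, m)` under Rains-preserving operations. -/
def distillationFidelity (ρ : Matrix (A × B) (A × B) ℂ) (m : ℕ) : ℝ :=
  sSup (achievableFidelities ρ m)

/-- The sizes `m ≥ 1` for which `Ψ_m` can be distilled with error at most `ε`. -/
def distillableSizes (ρ : Matrix (A × B) (A × B) ℂ) (ε : ℝ) : Set ℕ :=
  {m | 0 < m ∧ 1 - ε ≤ distillationFidelity ρ m}

/-- The one-shot `ε`-error distillable entanglement under Rains-preserving operations. -/
def oneShotDistillable (ρ : Matrix (A × B) (A × B) ℂ) (ε : ℝ) : ℝ :=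
  Real.logb 2 ((sSup (distillableSizes ρ ε) : ℕ) : ℝ)

end Distillation

/-- The polar `Q° = {X : ⟨X, Z⟩ ≤ 1 for all Z ∈ Q}` within the Hermitian matrices. -/
def polar {n : Type*} [Fintype n] (Q : Set (Matrix n n ℂ)) : Set (Matrix n n ℂ) :=
  {X | X.IsHermitian ∧ ∀ Z ∈ Q, hsInner X Z ≤ 1}

/-- The values `⟨ρ, W⟩` with `0 ⪯ W ⪯ 1` and `W ∈ (1/m) Q°`. -/
def gValues {n : Type*} [Fintype n] [DecidableEq n] (Q : Set (Matrix n n ℂ)) (m : ℝ)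
    (ρ : Matrix n n ℂ) : Set ℝ :=
  {g | ∃ W, IsEffect W ∧ W ∈ (1 / m) • polar Q ∧ g = hsInner ρ W}

/-- The quantity `G^{(m)}_Q(ρ)`. -/
def gQuantity {n : Type*} [Fintype n] [DecidableEq n] (Q : Set (Matrix n n ℂ)) (m : ℝ)
    (ρ : Matrix n n ℂ) : ℝ :=
  sSup (gValues Q m ρ)

/-- Binary logarithm with values in the extended reals and `log x = -∞` for `x ≤ 0`. -/
def elog2 (x : ℝ) : EReal :=
  if x ≤ 0 then ⊥ else ((Real.logb 2 x : ℝ) : EReal)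

/-- The hypothesis testing relative entropy
`D_H^ε(ρ‖X) = -log min {⟨M, X⟩ : 0 ⪯ M ⪯ 1, 1 - ⟨M, ρ⟩ ≤ ε}`. -/
def hypothesisTestingEntropy {n : Type*} [Fintype n] [DecidableEq n] (ε : ℝ)
    (ρ X : Matrix n n ℂ) : EReal :=
  -elog2 (sInf {t | ∃ M, IsEffect M ∧ 1 - hsInner M ρ ≤ ε ∧ t = hsInner M X})

/-- `⌊x⌋_log = log ⌊2^x⌋`, with logarithm in base 2. -/
def logFloor (x : ℝ) : ℝ :=
  Real.logb 2 ((⌊(2 : ℝ) ^ x⌋ : ℤ) : ℝ)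

end

end RainsDistillation

open RainsDistillation

/-! ### Trace norm of Hermitian matrices and its dual description. -/

section TraceNorm

variable {n : Type*} [Fintype n] [DecidableEq n]

/-! Upper bound on `F`: pull `Ψ_m` back through the adjoint channel to get an effect `W` with `⟨W,
X⟩ = ⟨Ψ_m, Λ X⟩`. The partial transpose of `Ψ_m` is the swap divided by `m`, and the swap is a
contraction, so `Ψ_m` overlaps every Rains operator by at most `1/m` (`hsInner_maxEntangled_le`).
Since `Λ` preserves the Rains set, `W` is feasible for `G`.

Lower bound: measure a feasible `W` and prepare `Ψ_m` on success, a suitable state on failure. A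
Rains input yields weights `w ≤ 1/m` and `u` with `w + u ≤ 1`, and every such mixture is again in
the Rains set (`exists_state_isotropic_mem_rainsSet`).

One-shot formula: by `F = G`, size `m` is distillable iff some test `M` of error at most `ε`
satisfies `⟨M, X⟩ ≤ 1/m` for all Rains `X`, that is, iff `m v ≤ 1` with `v = min_M max_X ⟨M, X⟩`.
Sion's theorem (`exists_minimax_test`) gives a saddle point, so also `v = max_X min_M ⟨M, X⟩`, and
the minimum of `D_H` is `-log₂ v`. The largest size is therefore `⌊1/v⌋`. -/

lemma Matrix.IsHermitian.trace_cfc {H : Matrix n n ℂ} (hH : H.IsHermitian) (f : ℝ → ℝ) :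
    (hH.cfc f).trace = ∑ i, (f (hH.eigenvalues i) : ℂ) := by
  rw [Matrix.IsHermitian.cfc, Unitary.conjStarAlgAut_apply, Matrix.trace_mul_cycle,
    Unitary.coe_star_mul_self, one_mul, Matrix.trace_diagonal]
  rfl

lemma Matrix.IsHermitian.cfc_mul_cfc {H : Matrix n n ℂ} (hH : H.IsHermitian) (f g : ℝ → ℝ) :
    hH.cfc f * hH.cfc g = hH.cfc (fun x => f x * g x) := by
  simp only [Matrix.IsHermitian.cfc, ← map_mul, Matrix.diagonal_mul_diagonal]
  congr 2
  ext i
  simp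

lemma Matrix.IsHermitian.cfc_id_eq {H : Matrix n n ℂ} (hH : H.IsHermitian) :
    hH.cfc (fun x => x) = H := by
  conv_rhs => rw [hH.spectral_theorem]
  rfl

lemma Matrix.IsHermitian.cfc_add_cfc {H : Matrix n n ℂ} (hH : H.IsHermitian) (f g : ℝ → ℝ) :
    hH.cfc f + hH.cfc g = hH.cfc (fun x => f x + g x) := by
  simp only [Matrix.IsHermitian.cfc, ← map_add, Matrix.diagonal_add]
  congr 2
  ext i
  simp

lemma Matrix.IsHermitian.cfc_sub_cfc {H : Matrix n n ℂ} (hH : H.IsHermitian) (f g : ℝ → ℝ) :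
    hH.cfc f - hH.cfc g = hH.cfc (fun x => f x - g x) := by
  simp only [Matrix.IsHermitian.cfc, ← map_sub, Matrix.diagonal_sub]
  congr 2
  ext i
  simp

lemma Matrix.IsHermitian.cfc_one_eq {H : Matrix n n ℂ} (hH : H.IsHermitian) :
    hH.cfc (fun _ => 1) = 1 := by
  simp [Matrix.IsHermitian.cfc, Function.comp_def]

lemma Matrix.IsHermitian.cfc_posSemidef {H : Matrix n n ℂ} (hH : H.IsHermitian) {f : ℝ → ℝ}
    (hf : ∀ x, 0 ≤ f x) : (hH.cfc f).PosSemidef := by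
  rw [Matrix.IsHermitian.cfc, Unitary.conjStarAlgAut_apply, Matrix.star_eq_conjTranspose]
  apply Matrix.PosSemidef.mul_mul_conjTranspose_same
  apply Matrix.PosSemidef.diagonal
  intro i
  simpa using hf _

/-- The eigenvalues of `H† H` and the squared eigenvalues of `H` are the same multiset, namely the
roots of one characteristic polynomial; the sum of square roots does not see their ordering. -/
lemma traceNorm_eq_sum_abs {H : Matrix n n ℂ} (hH : H.IsHermitian) :
    traceNorm H = ∑ i, |hH.eigenvalues i| := by
  have hsq : Hᴴ * H = hH.cfc (fun x => x * x) := by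
    rw [← hH.cfc_mul_cfc, hH.cfc_id_eq, hH.eq]
  have h1 := (Matrix.isHermitian_conjTranspose_mul_self H).roots_charpoly_eq_eigenvalues
  have h2 : (Hᴴ * H).charpoly.roots =
      Multiset.map (fun i => ((hH.eigenvalues i * hH.eigenvalues i : ℝ) : ℂ)) Finset.univ.val := by
    rw [hsq, Matrix.IsHermitian.cfc, Unitary.conjStarAlgAut_apply, Matrix.charpoly_mul_comm,
      ← mul_assoc, Unitary.coe_star_mul_self, one_mul, Matrix.charpoly_diagonal,
      Polynomial.roots_prod]
    · simp only [Function.comp_apply, Polynomial.roots_X_sub_C]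
      exact Multiset.bind_singleton _ _
    · exact Finset.prod_ne_zero_iff.2 fun i _ => Polynomial.X_sub_C_ne_zero _
  have h3 := congrArg (fun s : Multiset ℂ => (s.map fun z => Real.sqrt z.re).sum) (h1.symm.trans h2)
  simp only [Multiset.map_map, Function.comp_def] at h3
  simp only [Complex.ofReal_re, Complex.coe_algebraMap, Real.sqrt_mul_self_eq_abs] at h3
  exact h3

/-- Jordan decomposition together with a sign operator, both computing the trace norm. -/
lemma exists_jordan_decomposition {H : Matrix n n ℂ} (hH : H.IsHermitian) :
    ∃ P N C : Matrix n n ℂ, P.PosSemidef ∧ N.PosSemidef ∧ (1 - C).PosSemidef ∧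
      (1 + C).PosSemidef ∧ H = P - N ∧ traceNorm H = P.trace.re + N.trace.re ∧
      traceNorm H = (C * H).trace.re := by
  refine ⟨hH.cfc (fun x => max x 0), hH.cfc (fun x => max (-x) 0),
    hH.cfc (fun x => if 0 ≤ x then 1 else -1), hH.cfc_posSemidef fun x => le_max_right _ _,
    hH.cfc_posSemidef fun x => le_max_right _ _, ?_, ?_, ?_, ?_, ?_⟩
  · rw [← hH.cfc_one_eq, hH.cfc_sub_cfc]
    apply hH.cfc_posSemidef
    intro x
    split_ifs <;> norm_num
  · rw [← hH.cfc_one_eq, hH.cfc_add_cfc]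
    apply hH.cfc_posSemidef
    intro x
    split_ifs <;> norm_num
  · rw [hH.cfc_sub_cfc]
    conv_lhs => rw [← hH.cfc_id_eq]
    congr 1
    ext x
    rcases le_total 0 x with h | h <;> simp [h]
  · rw [traceNorm_eq_sum_abs hH, hH.trace_cfc, hH.trace_cfc, Complex.re_sum, Complex.re_sum,
      ← Finset.sum_add_distrib]
    refine Finset.sum_congr rfl fun i _ => ?_
    rcases le_total 0 (hH.eigenvalues i) with h | h
    · simp [h, abs_of_nonneg h]
    · simp [h, abs_of_nonpos h]
  · have h1 := hH.cfc_mul_cfc (fun x => if 0 ≤ x then 1 else -1) (fun x => x)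
    rw [hH.cfc_id_eq] at h1
    rw [traceNorm_eq_sum_abs hH, h1, hH.trace_cfc, Complex.re_sum]
    refine Finset.sum_congr rfl fun i _ => ?_
    rcases le_or_gt 0 (hH.eigenvalues i) with h | h
    · simp [h, abs_of_nonneg h]
    · simp [not_le.2 h, abs_of_neg h]

open scoped MatrixOrder in
lemma Matrix.PosSemidef.exists_eq_conjTranspose_mul_self {P : Matrix n n ℂ} (hP : P.PosSemidef) :
    ∃ B : Matrix n n ℂ, P = Bᴴ * B :=
  CStarAlgebra.nonneg_iff_eq_star_mul_self.1 hP.nonneg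

lemma trace_mul_nonneg {P Q : Matrix n n ℂ} (hP : P.PosSemidef) (hQ : Q.PosSemidef) :
    0 ≤ (P * Q).trace := by
  obtain ⟨B, rfl⟩ := hP.exists_eq_conjTranspose_mul_self
  rw [Matrix.mul_assoc, Matrix.trace_mul_comm]
  exact (hQ.mul_mul_conjTranspose_same B).trace_nonneg

lemma trace_mul_re_nonneg {P Q : Matrix n n ℂ} (hP : P.PosSemidef) (hQ : Q.PosSemidef) :
    0 ≤ (P * Q).trace.re :=
  (Complex.le_def.1 (trace_mul_nonneg hP hQ)).1

lemma trace_mul_sub_re_le {P N C : Matrix n n ℂ} (hP : P.PosSemidef) (hN : N.PosSemidef)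
    (h1 : (1 - C).PosSemidef) (h2 : (1 + C).PosSemidef) :
    (C * (P - N)).trace.re ≤ P.trace.re + N.trace.re := by
  have h3 := trace_mul_re_nonneg h1 hP
  have h4 := trace_mul_re_nonneg h2 hN
  simp only [Matrix.sub_mul, Matrix.add_mul, Matrix.mul_sub, one_mul, Matrix.trace_sub,
    Matrix.trace_add, Complex.sub_re, Complex.add_re] at h3 h4 ⊢
  linarith

lemma trace_mul_re_le_traceNorm {H C : Matrix n n ℂ} (hH : H.IsHermitian)
    (h1 : (1 - C).PosSemidef) (h2 : (1 + C).PosSemidef) :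
    (C * H).trace.re ≤ traceNorm H := by
  obtain ⟨P, N, _, hP, hN, -, -, h, ht, -⟩ := exists_jordan_decomposition hH
  rw [ht, h]
  exact trace_mul_sub_re_le hP hN h1 h2

/-- Any decomposition into positive parts, not only the Jordan one, certifies an upper bound. -/
lemma traceNorm_sub_le {P N : Matrix n n ℂ} (hP : P.PosSemidef) (hN : N.PosSemidef) :
    traceNorm (P - N) ≤ P.trace.re + N.trace.re := by
  obtain ⟨_, _, C, -, -, h1, h2, -, -, ht⟩ := exists_jordan_decomposition (hP.1.sub hN.1)
  rw [ht]
  exact trace_mul_sub_re_le hP hN h1 h2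

/-- Duality with the contractions `-1 ⪯ C ⪯ 1`. It presents the norm ball as an intersection of
half-spaces, from which closedness and convexity of the Rains set follow. -/
lemma traceNorm_le_iff {H : Matrix n n ℂ} (hH : H.IsHermitian) (c : ℝ) :
    traceNorm H ≤ c ↔
      ∀ C : Matrix n n ℂ, (1 - C).PosSemidef → (1 + C).PosSemidef → (C * H).trace.re ≤ c := by
  refine ⟨fun h C h1 h2 => (trace_mul_re_le_traceNorm hH h1 h2).trans h, fun h => ?_⟩
  obtain ⟨_, _, C, -, -, h1, h2, -, -, ht⟩ := exists_jordan_decomposition hH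
  exact ht ▸ h C h1 h2

end TraceNorm

/-! ### The real Hilbert–Schmidt pairing. -/

section HilbertSchmidt

variable {n : Type*} [Fintype n]

lemma hsInner_of_isHermitian {X : Matrix n n ℂ} (hX : X.IsHermitian) (Y : Matrix n n ℂ) :
    hsInner X Y = (X * Y).trace.re := by
  rw [hsInner, hX.eq]

lemma hsInner_comm (X Y : Matrix n n ℂ) : hsInner X Y = hsInner Y X := by
  rw [hsInner, hsInner, ← Complex.conj_re, starRingEnd_apply,
    ← Matrix.trace_conjTranspose, Matrix.conjTranspose_mul, Matrix.conjTranspose_conjTranspose]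

lemma hsInner_add_right (X Y Z : Matrix n n ℂ) :
    hsInner X (Y + Z) = hsInner X Y + hsInner X Z := by
  simp [hsInner, Matrix.mul_add]

lemma hsInner_sub_right (X Y Z : Matrix n n ℂ) :
    hsInner X (Y - Z) = hsInner X Y - hsInner X Z := by
  simp [hsInner, Matrix.mul_sub]

lemma hsInner_smul_right (c : ℝ) (X Y : Matrix n n ℂ) :
    hsInner X (c • Y) = c * hsInner X Y := by
  simp [hsInner]

lemma hsInner_smul_left (c : ℝ) (X Y : Matrix n n ℂ) :
    hsInner (c • X) Y = c * hsInner X Y := by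
  rw [hsInner_comm, hsInner_smul_right, hsInner_comm]

lemma hsInner_one_left [DecidableEq n] (X : Matrix n n ℂ) : hsInner 1 X = X.trace.re := by
  simp [hsInner]

/-- Pairing with a fixed matrix, as a real linear functional. -/
def hsInnerₗ (X : Matrix n n ℂ) : Matrix n n ℂ →ₗ[ℝ] ℝ where
  toFun := hsInner X
  map_add' := hsInner_add_right X
  map_smul' c Y := by simp [hsInner_smul_right]

lemma continuous_hsInner_right (X : Matrix n n ℂ) : Continuous fun Y => hsInner X Y := by
  unfold hsInner
  exact Complex.continuous_re.comp (continuous_const.matrix_mul continuous_id).matrix_trace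

lemma continuous_hsInner_left (Y : Matrix n n ℂ) : Continuous fun X => hsInner X Y := by
  simpa only [hsInner_comm _ Y] using continuous_hsInner_right Y

lemma hsInner_nonneg [DecidableEq n] {X Y : Matrix n n ℂ} (hX : X.PosSemidef)
    (hY : Y.PosSemidef) : 0 ≤ hsInner X Y := by
  rw [hsInner_of_isHermitian hX.1]
  exact trace_mul_re_nonneg hX hY

lemma IsEffect.hsInner_le [DecidableEq n] {M X : Matrix n n ℂ} (hM : IsEffect M)
    (hX : X.PosSemidef) : hsInner M X ≤ X.trace.re := by
  have h := hsInner_nonneg hX hM.2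
  rw [hsInner_sub_right, hsInner_comm X 1, hsInner_one_left, hsInner_comm X M] at h
  linarith

end HilbertSchmidt

/-! ### Compactness and convexity of positive matrices and effects. -/

section Compactness

variable {n : Type*} [Fintype n] [DecidableEq n]

omit [DecidableEq n] in
lemma isClosed_posSemidef : IsClosed {M : Matrix n n ℂ | M.PosSemidef} := by
  have h : {M : Matrix n n ℂ | M.PosSemidef} =
      {M | Mᴴ = M} ∩ ⋂ x : n → ℂ, {M | 0 ≤ star x ⬝ᵥ (M *ᵥ x)} := by
    ext M
    simp [Matrix.posSemidef_iff_dotProduct_mulVec, Matrix.IsHermitian]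
  rw [h]
  refine (isClosed_eq continuous_id.matrix_conjTranspose continuous_id).inter
    (isClosed_iInter fun x => isClosed_le continuous_const ?_)
  exact continuous_const.dotProduct (continuous_id.matrix_mulVec continuous_const)

/-- In Gram form `M = B† B`, the inequality `xy ≤ (x² + y²)/2` bounds an entry by the average of two
diagonal entries. -/
lemma Matrix.PosSemidef.norm_apply_le_trace {M : Matrix n n ℂ} (hM : M.PosSemidef) (i j : n) :
    ‖M i j‖ ≤ M.trace.re := by
  obtain ⟨B, rfl⟩ := hM.exists_eq_conjTranspose_mul_self
  have hdiag : ∀ j, ((Bᴴ * B) j j).re = ∑ k, ‖B k j‖ ^ 2 := by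
    intro j
    simp only [Matrix.mul_apply, Matrix.conjTranspose_apply, Complex.re_sum]
    refine Finset.sum_congr rfl fun k _ => ?_
    rw [← starRingEnd_apply, ← Complex.normSq_eq_conj_mul_self, Complex.normSq_eq_norm_sq,
      Complex.ofReal_re]
  have hle : ∀ j, ∑ k, ‖B k j‖ ^ 2 ≤ (Bᴴ * B).trace.re := by
    intro j
    rw [Matrix.trace, Complex.re_sum]
    simp only [Matrix.diag_apply, hdiag]
    exact Finset.single_le_sum (f := fun j => ∑ k, ‖B k j‖ ^ 2)
      (fun _ _ => Finset.sum_nonneg fun _ _ => sq_nonneg _) (Finset.mem_univ j)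
  have h1 : ‖(Bᴴ * B) i j‖ ≤ ∑ k, (‖B k i‖ ^ 2 + ‖B k j‖ ^ 2) / 2 := by
    rw [Matrix.mul_apply]
    refine (norm_sum_le _ _).trans (Finset.sum_le_sum fun k _ => ?_)
    rw [norm_mul, Matrix.conjTranspose_apply, norm_star]
    nlinarith [sq_nonneg (‖B k i‖ - ‖B k j‖)]
  rw [← Finset.sum_div, Finset.sum_add_distrib] at h1
  linarith [hle i, hle j]

lemma isCompact_posSemidef_trace_le (c : ℝ) :
    IsCompact {M : Matrix n n ℂ | M.PosSemidef ∧ M.trace.re ≤ c} := by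
  have hK : IsCompact (Set.univ.pi fun _ : n => Set.univ.pi fun _ : n => Metric.closedBall (0 : ℂ) c) :=
    isCompact_univ_pi fun _ => isCompact_univ_pi fun _ => isCompact_closedBall _ _
  refine IsCompact.of_isClosed_subset (s := (Set.univ.pi fun _ : n => Set.univ.pi fun _ : n =>
    Metric.closedBall (0 : ℂ) c : Set (Matrix n n ℂ))) hK ?_ ?_
  · exact isClosed_posSemidef.inter (isClosed_le
      (Complex.continuous_re.comp continuous_id.matrix_trace) continuous_const)
  · rintro M ⟨hM, ht⟩ i - j -
    simpa using (hM.norm_apply_le_trace i j).trans ht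

lemma isClosed_isEffect : IsClosed {M : Matrix n n ℂ | IsEffect M} :=
  isClosed_posSemidef.inter (isClosed_posSemidef.preimage (continuous_const.sub continuous_id))

lemma isCompact_isEffect : IsCompact {M : Matrix n n ℂ | IsEffect M} := by
  refine (isCompact_posSemidef_trace_le ((1 : Matrix n n ℂ).trace.re)).of_isClosed_subset
    isClosed_isEffect fun M hM => ⟨hM.1, ?_⟩
  have h := (Complex.le_def.1 hM.2.trace_nonneg).1
  rw [Matrix.trace_sub, Complex.sub_re, Complex.zero_re] at h
  linarith

omit [Fintype n] [DecidableEq n] in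
lemma Matrix.PosSemidef.real_smul {M : Matrix n n ℂ} (hM : M.PosSemidef) {a : ℝ} (ha : 0 ≤ a) :
    (a • M).PosSemidef :=
  hM.smul ha

omit [Fintype n] [DecidableEq n] in
lemma convex_posSemidef : Convex ℝ {M : Matrix n n ℂ | M.PosSemidef} :=
  fun _ hX _ hY _ _ ha hb _ => (hX.real_smul ha).add (hY.real_smul hb)

omit [Fintype n] in
lemma convex_isEffect : Convex ℝ {M : Matrix n n ℂ | IsEffect M} := by
  intro X hX Y hY a b ha hb hab
  refine ⟨convex_posSemidef hX.1 hY.1 ha hb hab, ?_⟩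
  have h := convex_posSemidef hX.2 hY.2 ha hb hab
  have h2 : a • (1 - X) + b • (1 - Y) = 1 - (a • X + b • Y) := by
    have h3 : (1 : Matrix n n ℂ) = a • 1 + b • 1 := by rw [← add_smul, hab, one_smul]
    conv_rhs => rw [h3]
    module
  rwa [h2] at h

omit [Fintype n] in
lemma isEffect_one : IsEffect (1 : Matrix n n ℂ) :=
  ⟨Matrix.PosSemidef.one, by simpa using Matrix.PosSemidef.zero⟩

omit [DecidableEq n] in
lemma mem_one_div_smul_polar {Q : Set (Matrix n n ℂ)} {m : ℝ} (hm : 0 < m) {W : Matrix n n ℂ}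
    (hW : W.IsHermitian) :
    W ∈ (1 / m) • polar Q ↔ ∀ Z ∈ Q, hsInner W Z ≤ 1 / m := by
  rw [Set.mem_smul_set_iff_inv_smul_mem₀ (by positivity)]
  have hH : ((1 / m)⁻¹ • W).IsHermitian := by
    rw [Matrix.IsHermitian, Matrix.conjTranspose_smul, hW.eq, star_trivial]
  simp only [polar, Set.mem_ofPred_eq, hH, true_and, hsInner_smul_left]
  refine forall₂_congr fun Z _ => ?_
  rw [one_div, inv_inv, ← one_div, le_div_iff₀ hm, mul_comm]

end Compactness

/-! ### Partial transposition and the Rains set. -/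

section PartialTranspose

variable {A B : Type*}

lemma partialTranspose_apply (X : Matrix (A × B) (A × B) ℂ) (p q : A × B) :
    partialTranspose X p q = X (p.1, q.2) (q.1, p.2) := rfl

lemma partialTranspose_add (X Y : Matrix (A × B) (A × B) ℂ) :
    partialTranspose (X + Y) = partialTranspose X + partialTranspose Y := rfl

lemma partialTranspose_sub (X Y : Matrix (A × B) (A × B) ℂ) :
    partialTranspose (X - Y) = partialTranspose X - partialTranspose Y := rfl

lemma partialTranspose_smul (c : ℝ) (X : Matrix (A × B) (A × B) ℂ) :
    partialTranspose (c • X) = c • partialTranspose X := rfl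

lemma Matrix.IsHermitian.partialTranspose {X : Matrix (A × B) (A × B) ℂ} (hX : X.IsHermitian) :
    (partialTranspose X).IsHermitian := by
  ext p q
  exact hX.apply _ _

lemma continuous_partialTranspose :
    Continuous (partialTranspose : Matrix (A × B) (A × B) ℂ → _) :=
  continuous_matrix fun _ _ => continuous_id.matrix_elem _ _

variable [DecidableEq A] [DecidableEq B]

lemma partialTranspose_one : partialTranspose (1 : Matrix (A × B) (A × B) ℂ) = 1 := by
  ext ⟨a, b⟩ ⟨c, d⟩
  simp [partialTranspose_apply, Matrix.one_apply, eq_comm]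

variable [Fintype A] [Fintype B]

omit [DecidableEq A] [DecidableEq B] in
lemma trace_partialTranspose (X : Matrix (A × B) (A × B) ℂ) :
    (partialTranspose X).trace = X.trace := rfl

-- Both traces are the same sum with the two `B` indices renamed.
omit [DecidableEq A] [DecidableEq B] in
lemma trace_partialTranspose_mul (X Y : Matrix (A × B) (A × B) ℂ) :
    (partialTranspose X * partialTranspose Y).trace = (X * Y).trace := by
  simp only [Matrix.trace, Matrix.diag_apply, Matrix.mul_apply, partialTranspose_apply,
    Fintype.sum_prod_type]
  refine Finset.sum_congr rfl fun a _ => ?_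
  rw [Finset.sum_comm]
  conv_rhs => rw [Finset.sum_comm]
  refine Finset.sum_congr rfl fun c _ => ?_
  rw [Finset.sum_comm]

lemma mem_rainsSet_iff {X : Matrix (A × B) (A × B) ℂ} :
    X ∈ rainsSet A B ↔ X.PosSemidef ∧ ∀ C : Matrix (A × B) (A × B) ℂ, (1 - C).PosSemidef →
      (1 + C).PosSemidef → (C * partialTranspose X).trace.re ≤ 1 := by
  refine and_congr_right fun hX => ?_
  exact traceNorm_le_iff hX.1.partialTranspose 1

lemma trace_re_le_one_of_mem_rainsSet {X : Matrix (A × B) (A × B) ℂ} (hX : X ∈ rainsSet A B) :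
    X.trace.re ≤ 1 := by
  -- The identity is an admissible contraction, and partial transposition keeps the trace.
  have h := (mem_rainsSet_iff.1 hX).2 1 (by simpa using Matrix.PosSemidef.zero)
    (Matrix.PosSemidef.one.add Matrix.PosSemidef.one)
  rwa [one_mul, trace_partialTranspose] at h

lemma isCompact_rainsSet : IsCompact (rainsSet A B) := by
  refine (isCompact_posSemidef_trace_le 1).of_isClosed_subset ?_
    fun X hX => ⟨hX.1, trace_re_le_one_of_mem_rainsSet hX⟩
  have h : rainsSet A B = {X | X.PosSemidef} ∩ ⋂ (C : Matrix (A × B) (A × B) ℂ)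
      (_ : (1 - C).PosSemidef) (_ : (1 + C).PosSemidef),
        {X | (C * partialTranspose X).trace.re ≤ 1} := by
    ext X
    simp [mem_rainsSet_iff]
  rw [h]
  refine isClosed_posSemidef.inter (isClosed_iInter fun C => isClosed_iInter fun _ =>
    isClosed_iInter fun _ => isClosed_le ?_ continuous_const)
  exact Complex.continuous_re.comp
    (continuous_const.matrix_mul continuous_partialTranspose).matrix_trace

lemma convex_rainsSet : Convex ℝ (rainsSet A B) := by
  intro X hX Y hY a b ha hb hab
  rw [mem_rainsSet_iff] at *
  refine ⟨convex_posSemidef hX.1 hY.1 ha hb hab, fun C h1 h2 => ?_⟩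
  have hx := hX.2 C h1 h2
  have hy := hY.2 C h1 h2
  rw [partialTranspose_add, partialTranspose_smul, partialTranspose_smul, Matrix.mul_add,
    Matrix.mul_smul, Matrix.mul_smul, Matrix.trace_add, Matrix.trace_smul, Matrix.trace_smul,
    Complex.add_re, Complex.real_smul, Complex.real_smul, Complex.re_ofReal_mul,
    Complex.re_ofReal_mul]
  nlinarith

/-- Every positive semidefinite matrix has a positive multiple in the Rains set. -/
lemma exists_pos_smul_mem_rainsSet {X : Matrix (A × B) (A × B) ℂ} (hX : X.PosSemidef) :
    ∃ c : ℝ, 0 < c ∧ c • X ∈ rainsSet A B := by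
  set t := traceNorm (partialTranspose X)
  have hpos : 0 < 1 + |t| := by positivity
  refine ⟨(1 + |t|)⁻¹, inv_pos.2 hpos, mem_rainsSet_iff.2
    ⟨hX.real_smul (inv_pos.2 hpos).le, fun C h1 h2 => ?_⟩⟩
  have h := trace_mul_re_le_traceNorm hX.1.partialTranspose h1 h2
  rw [partialTranspose_smul, Matrix.mul_smul, Matrix.trace_smul, Complex.real_smul,
    Complex.re_ofReal_mul, inv_mul_le_iff₀ hpos]
  linarith [le_abs_self t]

end PartialTranspose

/-! ### Adjoints of channels and measure-and-prepare maps. -/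

section Channels

variable {n p : Type*} [Fintype n]

/-- Self-duality of the positive semidefinite cone. -/
lemma posSemidef_of_trace_mul_nonneg [DecidableEq n] {W : Matrix n n ℂ}
    (h : ∀ X : Matrix n n ℂ, X.PosSemidef → 0 ≤ (W * X).trace) : W.PosSemidef := by
  rw [← Matrix.isPositive_toEuclideanLin_iff, LinearMap.isPositive_iff_complex]
  intro x
  -- Rank-one matrices `x x†` recover the quadratic form of `W`.
  have hx := h _ (Matrix.posSemidef_vecMulVec_self_star x.ofLp)
  have heq : inner ℂ (W.toEuclideanLin x) x =
      star (W * Matrix.vecMulVec x.ofLp (star x.ofLp)).trace := by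
    rw [Matrix.mul_vecMulVec, Matrix.trace_vecMulVec, EuclideanSpace.inner_eq_star_dotProduct]
    rw [← Matrix.star_dotProduct_star, star_star]
    rfl
  rw [heq]
  obtain ⟨h1, h2⟩ := Complex.le_def.1 hx
  refine ⟨?_, ?_⟩
  · apply Complex.ext
    · simp
    · simpa using h2.symm
  · simpa using h1

omit [Fintype n] in
lemma RainsDistillation.IsCompletelyPositive.posSemidef {Λ : Matrix n n ℂ →ₗ[ℂ] Matrix p p ℂ}
    (hΛ : IsCompletelyPositive Λ) {X : Matrix n n ℂ} (hX : X.PosSemidef) : (Λ X).PosSemidef :=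
  (hΛ 1 (X.submatrix Prod.snd Prod.snd) (hX.submatrix _)).submatrix fun a => (0, a)

/-- The image of an effect under the adjoint of a completely positive trace-preserving map. -/
lemma exists_adjoint_effect [DecidableEq n] [Fintype p] [DecidableEq p]
    {Λ : Matrix n n ℂ →ₗ[ℂ] Matrix p p ℂ} (hΛ : IsCPTP Λ) {Q : Matrix p p ℂ} (hQ : IsEffect Q) :
    ∃ W, IsEffect W ∧ ∀ X, hsInner W X = hsInner Q (Λ X) := by
  let W : Matrix n n ℂ := Matrix.of fun a b => (Q * Λ (Matrix.single b a 1)).trace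
  have hW : ∀ X, (W * X).trace = (Q * Λ X).trace := by
    intro X
    conv_rhs => rw [Matrix.matrix_eq_sum_single X]
    simp only [map_sum, Matrix.mul_sum, Matrix.trace_sum]
    rw [Finset.sum_comm]
    have hWX : (W * X).trace = ∑ a, ∑ b, W a b * X b a := by
      simp [Matrix.trace, Matrix.mul_apply]
    rw [hWX]
    refine Finset.sum_congr rfl fun a _ => Finset.sum_congr rfl fun b _ => ?_
    have hs : Matrix.single b a (X b a) = X b a • Matrix.single b a (1 : ℂ) := by simp
    rw [hs, map_smul, Matrix.mul_smul, Matrix.trace_smul, smul_eq_mul, mul_comm]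
    rfl
  have hpos : W.PosSemidef := posSemidef_of_trace_mul_nonneg fun X hX => by
    rw [hW]
    exact trace_mul_nonneg hQ.1 (IsCompletelyPositive.posSemidef hΛ.1 hX)
  refine ⟨W, ⟨hpos, posSemidef_of_trace_mul_nonneg fun X hX => ?_⟩, fun X => ?_⟩
  · rw [Matrix.sub_mul, one_mul, Matrix.trace_sub, hW, ← hΛ.2 X, ← Matrix.trace_sub]
    nth_rw 1 [← one_mul (Λ X)]
    rw [← Matrix.sub_mul]
    exact trace_mul_nonneg hQ.2 (IsCompletelyPositive.posSemidef hΛ.1 hX)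
  · rw [hsInner_of_isHermitian hpos.1, hsInner_of_isHermitian hQ.1.1, hW]

/-- The linear map `X ↦ Tr (W X) P`. -/
def traceMulSMul (W : Matrix n n ℂ) (P : Matrix p p ℂ) : Matrix n n ℂ →ₗ[ℂ] Matrix p p ℂ where
  toFun X := (W * X).trace • P
  map_add' X Y := by simp [Matrix.mul_add, add_smul]
  map_smul' c X := by simp [smul_smul]

/-- With `W = B† B`, the map `id_k ⊗ Tr(W ·)` is the Kraus sum of the `V c`, where `V c` is `id_k`
tensored with row `c` of `B`; tensoring the positive result with `P` keeps it positive. -/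
lemma isCompletelyPositive_traceMulSMul [DecidableEq n] [Finite p] {W : Matrix n n ℂ}
    {P : Matrix p p ℂ} (hW : W.PosSemidef) (hP : P.PosSemidef) :
    IsCompletelyPositive (traceMulSMul W P) := by
  intro k M hM
  obtain ⟨B, rfl⟩ := hW.exists_eq_conjTranspose_mul_self
  let V : n → Matrix (Fin k) (Fin k × n) ℂ := fun c =>
    Matrix.of fun x y => if x = y.1 then B c y.2 else 0
  have hN : (∑ c, V c * M * (V c)ᴴ).PosSemidef :=
    Matrix.posSemidef_sum _ fun c _ => hM.mul_mul_conjTranspose_same _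
  have h : ampliation k (traceMulSMul (Bᴴ * B) P) M =
      Matrix.kroneckerMap (· * ·) (∑ c, V c * M * (V c)ᴴ) P := by
    ext ⟨x, a⟩ ⟨y, b⟩
    have key : (Bᴴ * B * Matrix.of fun a b => M (x, a) (y, b)).trace =
        (∑ c, V c * M * (V c)ᴴ) x y := by
      rw [Matrix.mul_assoc, Matrix.trace_mul_comm, Matrix.sum_apply, Matrix.trace]
      refine Finset.sum_congr rfl fun c _ => ?_
      simp [V, Matrix.mul_apply, Fintype.sum_prod_type, apply_ite, ite_mul,
        Finset.sum_ite_irrel]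
    simp only [ampliation, traceMulSMul, LinearMap.coe_mk, AddHom.coe_mk, Matrix.of_apply,
      Matrix.smul_apply, smul_eq_mul, Matrix.kroneckerMap_apply, key]
  rw [h]
  exact hN.kronecker hP

/-- Measuring the effect `W` and preparing `P` or `Q` according to the outcome. -/
def measurePrepare [DecidableEq n] (W : Matrix n n ℂ) (P Q : Matrix p p ℂ) :
    Matrix n n ℂ →ₗ[ℂ] Matrix p p ℂ :=
  traceMulSMul W P + traceMulSMul (1 - W) Q

lemma measurePrepare_apply [DecidableEq n] (W : Matrix n n ℂ) (P Q : Matrix p p ℂ)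
    (X : Matrix n n ℂ) :
    measurePrepare W P Q X = (W * X).trace • P + ((1 - W) * X).trace • Q := rfl

lemma isCPTP_measurePrepare [DecidableEq n] [Fintype p] {W : Matrix n n ℂ} {P Q : Matrix p p ℂ}
    (hW : IsEffect W) (hP : IsState P) (hQ : IsState Q) : IsCPTP (measurePrepare W P Q) := by
  refine ⟨fun k M hM => ?_, fun X => ?_⟩
  · exact (isCompletelyPositive_traceMulSMul hW.1 hP.1 k M hM).add
      (isCompletelyPositive_traceMulSMul hW.2 hQ.1 k M hM)
  · rw [measurePrepare_apply, Matrix.trace_add, Matrix.trace_smul, Matrix.trace_smul, hP.2, hQ.2,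
      Matrix.sub_mul, Matrix.trace_sub]
    simp

/-- On positive matrices the outcome weights are real. -/
lemma trace_mul_eq_ofReal_hsInner [DecidableEq n] {W X : Matrix n n ℂ} (hW : W.PosSemidef)
    (hX : X.PosSemidef) : (W * X).trace = (hsInner W X : ℂ) := by
  rw [hsInner_of_isHermitian hW.1]
  exact Complex.ext rfl (Complex.le_def.1 (trace_mul_nonneg hW hX)).2.symm

lemma measurePrepare_apply_of_posSemidef [DecidableEq n] {W X : Matrix n n ℂ} (hW : IsEffect W)
    (hX : X.PosSemidef) (P Q : Matrix p p ℂ) :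
    measurePrepare W P Q X = hsInner W X • P + hsInner (1 - W) X • Q := by
  rw [measurePrepare_apply, trace_mul_eq_ofReal_hsInner hW.1 hX,
    trace_mul_eq_ofReal_hsInner hW.2 hX]
  simp

end Channels

/-! ### The swap, the maximally entangled state and isotropic mixtures. -/

section MaxEntangled

/-- The operator exchanging the two tensor factors of `ℂᵐ ⊗ ℂᵐ`. -/
def swapMatrix (m : ℕ) : Matrix (Fin m × Fin m) (Fin m × Fin m) ℂ :=
  (1 : Matrix (Fin m × Fin m) (Fin m × Fin m) ℂ).submatrix Prod.swap id

lemma swapMatrix_apply (m : ℕ) (p q : Fin m × Fin m) :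
    swapMatrix m p q = if p.swap = q then 1 else 0 := by
  simp [swapMatrix, Matrix.one_apply]

lemma swapMatrix_isHermitian (m : ℕ) : (swapMatrix m).IsHermitian := by
  ext ⟨a, b⟩ ⟨c, d⟩
  simp only [Matrix.conjTranspose_apply, swapMatrix_apply, Prod.swap, Prod.mk.injEq]
  by_cases h1 : b = c <;> by_cases h2 : a = d <;> simp [h1, h2, eq_comm]

lemma swapMatrix_mul_self (m : ℕ) : swapMatrix m * swapMatrix m = 1 := by
  ext p q
  simp only [Matrix.mul_apply, swapMatrix_apply, Matrix.one_apply, ite_mul, one_mul, zero_mul]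
  simp

lemma swapMatrix_trace (m : ℕ) : (swapMatrix m).trace = m := by
  simp only [Matrix.trace, Matrix.diag_apply, swapMatrix_apply, Fintype.sum_prod_type, Prod.swap,
    Prod.mk.injEq]
  have h : ∀ a b : Fin m, (b = a ∧ a = b) ↔ a = b := fun a b => ⟨fun h => h.2, fun h => ⟨h.symm, h⟩⟩
  simp [h]

/-- Half of `1 + S` is a projector, so `1 + S` is half its own square. -/
lemma one_add_posSemidef_of_mul_self {n : Type*} [Fintype n] [DecidableEq n] {S : Matrix n n ℂ}
    (hS : S.IsHermitian) (h : S * S = 1) : (1 + S).PosSemidef := by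
  have h1 : (1 + S) = (1 / 2 : ℝ) • ((1 + S)ᴴ * (1 + S)) := by
    rw [Matrix.conjTranspose_add, hS.eq, Matrix.conjTranspose_one, Matrix.add_mul, Matrix.mul_add,
      Matrix.mul_add, h, one_mul, one_mul, mul_one]
    module
  rw [h1]
  exact (Matrix.posSemidef_conjTranspose_mul_self _).real_smul (by norm_num)

lemma one_add_swapMatrix_posSemidef (m : ℕ) : (1 + swapMatrix m).PosSemidef :=
  one_add_posSemidef_of_mul_self (swapMatrix_isHermitian m) (swapMatrix_mul_self m)

lemma one_sub_swapMatrix_posSemidef (m : ℕ) : (1 - swapMatrix m).PosSemidef := by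
  rw [sub_eq_add_neg]
  exact one_add_posSemidef_of_mul_self (swapMatrix_isHermitian m).neg
    (by rw [neg_mul_neg, swapMatrix_mul_self])

lemma maxEntangled_apply (m : ℕ) (p q : Fin m × Fin m) :
    maxEntangled m p q = if p.1 = p.2 ∧ q.1 = q.2 then (m : ℂ)⁻¹ else 0 := by
  have h : ((Real.sqrt m : ℂ))⁻¹ * (Real.sqrt m : ℂ)⁻¹ = (m : ℂ)⁻¹ := by
    rw [← mul_inv, ← Complex.ofReal_mul, Real.mul_self_sqrt (Nat.cast_nonneg m),
      Complex.ofReal_natCast]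
  simp only [maxEntangled, maxEntangledKet, Matrix.vecMulVec_apply, Pi.star_apply]
  by_cases h1 : p.1 = p.2 <;> by_cases h2 : q.1 = q.2 <;> simp [h1, h2, h]

lemma partialTranspose_maxEntangled (m : ℕ) :
    partialTranspose (maxEntangled m) = (m : ℝ)⁻¹ • swapMatrix m := by
  ext ⟨a, b⟩ ⟨c, d⟩
  simp only [partialTranspose_apply, maxEntangled_apply, Matrix.smul_apply, swapMatrix_apply,
    Prod.swap, Prod.mk.injEq]
  by_cases h1 : a = d <;> by_cases h2 : b = c <;> simp [h1, h2, eq_comm (a := c)]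

lemma maxEntangled_trace {m : ℕ} (hm : 0 < m) : (maxEntangled m).trace = 1 := by
  rw [← trace_partialTranspose, partialTranspose_maxEntangled, Matrix.trace_smul, swapMatrix_trace]
  have : (m : ℂ) ≠ 0 := by exact_mod_cast hm.ne'
  simp [this]

lemma maxEntangled_posSemidef (m : ℕ) : (maxEntangled m).PosSemidef :=
  Matrix.posSemidef_vecMulVec_self_star _

lemma isState_maxEntangled {m : ℕ} (hm : 0 < m) : IsState (maxEntangled m) :=
  ⟨maxEntangled_posSemidef m, maxEntangled_trace hm⟩

lemma maxEntangled_mul_self {m : ℕ} (hm : 0 < m) :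
    maxEntangled m * maxEntangled m = maxEntangled m := by
  have h := maxEntangled_trace hm
  rw [maxEntangled, Matrix.trace_vecMulVec, dotProduct_comm] at h
  rw [maxEntangled, Matrix.vecMulVec_mul_vecMulVec, h, one_smul]

lemma isEffect_maxEntangled {m : ℕ} (hm : 0 < m) : IsEffect (maxEntangled m) := by
  refine ⟨maxEntangled_posSemidef m, ?_⟩
  have h : 1 - maxEntangled m = (1 - maxEntangled m)ᴴ * (1 - maxEntangled m) := by
    rw [Matrix.conjTranspose_sub, (maxEntangled_posSemidef m).1.eq, Matrix.conjTranspose_one,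
      Matrix.sub_mul, Matrix.mul_sub, Matrix.mul_sub,
      maxEntangled_mul_self hm]
    simp
  rw [h]
  exact Matrix.posSemidef_conjTranspose_mul_self _

lemma hsInner_maxEntangled_self {m : ℕ} (hm : 0 < m) :
    hsInner (maxEntangled m) (maxEntangled m) = 1 := by
  rw [hsInner_of_isHermitian (maxEntangled_posSemidef m).1, maxEntangled_mul_self hm,
    maxEntangled_trace hm, Complex.one_re]

lemma hsInner_maxEntangled_le {m : ℕ} {Y : Matrix (Fin m × Fin m) (Fin m × Fin m) ℂ}
    (hY : Y ∈ rainsSet (Fin m) (Fin m)) : hsInner (maxEntangled m) Y ≤ 1 / m := by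
  rw [hsInner_of_isHermitian (maxEntangled_posSemidef m).1, ← trace_partialTranspose_mul,
    partialTranspose_maxEntangled, Matrix.smul_mul, Matrix.trace_smul, Complex.real_smul,
    Complex.re_ofReal_mul, one_div]
  exact mul_le_of_le_one_right (by positivity) ((mem_rainsSet_iff.1 hY).2 _
    (one_sub_swapMatrix_posSemidef m) (one_add_swapMatrix_posSemidef m))

lemma posSemidef_mem_rainsSet_of_partialTranspose_eq {A B : Type*} [Fintype A] [Fintype B]
    [DecidableEq A] [DecidableEq B] {X P N : Matrix (A × B) (A × B) ℂ} (hX : X.PosSemidef)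
    (hP : P.PosSemidef) (hN : N.PosSemidef) (h : partialTranspose X = P - N)
    (ht : P.trace.re + N.trace.re ≤ 1) : X ∈ rainsSet A B :=
  ⟨hX, h ▸ (traceNorm_sub_le hP hN).trans ht⟩

/-- A failure state which keeps every isotropic mixture with small weight on `Ψ_m` in the
Rains set. -/
lemma exists_state_isotropic_mem_rainsSet {m : ℕ} (hm : 0 < m) :
    ∃ Q, IsState Q ∧ ∀ w u : ℝ, 0 ≤ w → 0 ≤ u → m * w ≤ 1 → w + u ≤ 1 →
      w • maxEntangled m + u • Q ∈ rainsSet (Fin m) (Fin m) := by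
  obtain rfl | hm1 : m = 1 ∨ 1 < m := by omega
  -- For `m = 1` the complement of `Ψ_m` vanishes and cannot be normalised, so `Ψ_1` itself serves
  -- as failure state.
  · refine ⟨maxEntangled 1, isState_maxEntangled hm, fun w u hw hu _ hwu => ?_⟩
    have hS : swapMatrix 1 = 1 := by
      ext p q
      simp [swapMatrix_apply, Matrix.one_apply, Subsingleton.elim p q, Subsingleton.elim q.swap q]
    have hpos := ((maxEntangled_posSemidef 1).real_smul hw).add
      ((maxEntangled_posSemidef 1).real_smul hu)
    refine posSemidef_mem_rainsSet_of_partialTranspose_eq hpos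
      (Matrix.PosSemidef.one.real_smul (add_nonneg hw hu)) .zero ?_ ?_
    · rw [partialTranspose_add, partialTranspose_smul, partialTranspose_smul,
        partialTranspose_maxEntangled, hS]
      norm_num [add_smul]
    · simpa using hwu
  have hm1' : (1 : ℝ) < m := by exact_mod_cast hm1
  have hD : (0 : ℝ) < (m : ℝ) ^ 2 - 1 := by nlinarith
  have hmm : (0 : ℝ) < m := by linarith
  have hmp : (0 : ℝ) < (m : ℝ) - 1 := by linarith
  have hmq : (0 : ℝ) < (m : ℝ) + 1 := by linarith
  set S := swapMatrix m with hS
  have hQpos : (((m : ℝ) ^ 2 - 1)⁻¹ • (1 - maxEntangled m)).PosSemidef :=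
    (isEffect_maxEntangled hm).2.real_smul (inv_pos.2 hD).le
  refine ⟨((m : ℝ) ^ 2 - 1)⁻¹ • (1 - maxEntangled m), ⟨hQpos, ?_⟩, fun w u hw hu hmw hwu => ?_⟩
  · rw [Matrix.trace_smul, Matrix.trace_sub, maxEntangled_trace hm, Matrix.trace_one,
      Fintype.card_prod, Fintype.card_fin, Complex.real_smul]
    have hD' : ((m : ℂ) ^ 2 - 1) ≠ 0 := by exact_mod_cast hD.ne'
    push_cast
    rw [← sq, inv_mul_cancel₀ hD']
  have hpos := ((maxEntangled_posSemidef m).real_smul hw).add (hQpos.real_smul hu)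
  -- The partial transpose of the mixture is a combination of `1` and `S`; `2a` and `2b` are its
  -- eigenvalues on the symmetric and antisymmetric subspaces.
  set a : ℝ := (w / m + u / (m * (m + 1))) / 2 with ha
  set b : ℝ := (u / (m * (m - 1)) - w / m) / 2 with hb
  have ha0 : 0 ≤ a := by positivity
  have htr : (1 + S).trace.re = m ^ 2 + m := by
    simp [hS, swapMatrix_trace, sq]
  have htr' : (1 - S).trace.re = m ^ 2 - m := by
    simp [hS, swapMatrix_trace, sq]
  have hpt : partialTranspose (w • maxEntangled m +
      u • ((m : ℝ) ^ 2 - 1)⁻¹ • (1 - maxEntangled m)) = a • (1 + S) + b • (1 - S) := by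
    rw [partialTranspose_add, partialTranspose_smul, partialTranspose_smul, partialTranspose_smul,
      partialTranspose_sub, partialTranspose_one, partialTranspose_maxEntangled]
    have e1 : a + b = u * ((m : ℝ) ^ 2 - 1)⁻¹ := by
      have : (m : ℝ) ^ 2 - 1 = (m - 1) * (m + 1) := by ring
      rw [ha, hb, this]
      field_simp
      ring
    have e2 : a - b = w * (m : ℝ)⁻¹ - u * ((m : ℝ) ^ 2 - 1)⁻¹ * (m : ℝ)⁻¹ := by
      have : (m : ℝ) ^ 2 - 1 = (m - 1) * (m + 1) := by ring
      rw [ha, hb, this]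
      field_simp
      ring
    have e3 : a • (1 + S) + b • (1 - S) = (a + b) • (1 : Matrix _ _ ℂ) + (a - b) • S := by module
    rw [e3, e1, e2]
    module
  have hS1 := one_add_swapMatrix_posSemidef m
  have hS2 := one_sub_swapMatrix_posSemidef m
  -- Only `b` can be negative. If `b ≥ 0` the total weight is the trace `w + u`; if `b ≤ 0` it is `m
  -- * w`. The two hypotheses on the weights cover exactly these cases.
  rcases le_total 0 b with hb0 | hb0
  · refine posSemidef_mem_rainsSet_of_partialTranspose_eq hpos
      ((hS1.real_smul ha0).add (hS2.real_smul hb0)) .zero (by rw [hpt, sub_zero]) ?_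
    rw [Matrix.trace_add, Matrix.trace_smul, Matrix.trace_smul, Complex.add_re, Complex.real_smul,
      Complex.real_smul, Complex.re_ofReal_mul, Complex.re_ofReal_mul, htr, htr',
      Matrix.trace_zero, Complex.zero_re, add_zero]
    calc _ = w + u := by rw [ha, hb]; field_simp; ring
      _ ≤ 1 := hwu
  · refine posSemidef_mem_rainsSet_of_partialTranspose_eq hpos
      (hS1.real_smul ha0) (hS2.real_smul (neg_nonneg.2 hb0)) (by rw [hpt]; module) ?_
    rw [Matrix.trace_smul, Matrix.trace_smul, Complex.real_smul,
      Complex.real_smul, Complex.re_ofReal_mul, Complex.re_ofReal_mul, htr, htr']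
    calc _ = m * w := by rw [ha, hb]; field_simp; ring
      _ ≤ 1 := hmw

end MaxEntangled

/-! ### Fidelity of distillation, and the minimax for hypothesis tests. -/

section Distillation

variable {A B : Type*} [Fintype A] [Fintype B] [DecidableEq A] [DecidableEq B]
  {ρ : Matrix (A × B) (A × B) ℂ}

lemma zero_mem_rainsSet : (0 : Matrix (A × B) (A × B) ℂ) ∈ rainsSet A B :=
  mem_rainsSet_iff.2 ⟨.zero, fun C _ _ => by
    have h : partialTranspose (0 : Matrix (A × B) (A × B) ℂ) = 0 := rfl
    simp [h]⟩

lemma mem_gValues_iff {m : ℕ} (hm : 0 < m) {g : ℝ} :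
    g ∈ gValues (rainsSet A B) m ρ ↔
      ∃ W, (IsEffect W ∧ ∀ Z ∈ rainsSet A B, hsInner W Z ≤ 1 / m) ∧ hsInner ρ W = g := by
  refine exists_congr fun W => ⟨fun h => ?_, fun h => ?_⟩
  · exact ⟨⟨h.1, (mem_one_div_smul_polar (by exact_mod_cast hm) h.1.1.1).1 h.2.1⟩, h.2.2.symm⟩
  · exact ⟨h.1.1, (mem_one_div_smul_polar (by exact_mod_cast hm) h.1.1.1.1).2 h.1.2, h.2.symm⟩

/-- The optimization defining `G` is attained. -/
lemma isGreatest_gQuantity {m : ℕ} (hm : 0 < m) :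
    IsGreatest (gValues (rainsSet A B) m ρ) (gQuantity (rainsSet A B) m ρ) := by
  have himg : gValues (rainsSet A B) m ρ = (fun W => hsInner ρ W) ''
      {W | IsEffect W ∧ ∀ Z ∈ rainsSet A B, hsInner W Z ≤ 1 / m} := by
    ext g
    exact mem_gValues_iff hm
  have hclosed : IsClosed {W : Matrix (A × B) (A × B) ℂ |
      IsEffect W ∧ ∀ Z ∈ rainsSet A B, hsInner W Z ≤ 1 / m} := by
    have h : {W : Matrix (A × B) (A × B) ℂ |
        IsEffect W ∧ ∀ Z ∈ rainsSet A B, hsInner W Z ≤ 1 / m} =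
        {W | IsEffect W} ∩ ⋂ Z ∈ rainsSet A B, {W | hsInner W Z ≤ 1 / m} := by
      ext W
      simp
    rw [h]
    exact isClosed_isEffect.inter (isClosed_biInter fun Z _ =>
      isClosed_le (continuous_hsInner_left Z) continuous_const)
  have hcompact := isCompact_isEffect.of_isClosed_subset hclosed fun W hW => hW.1
  rw [gQuantity, himg]
  refine (hcompact.image (continuous_hsInner_right ρ)).isGreatest_sSup (Set.Nonempty.image _
    ⟨0, ⟨.zero, by simpa using Matrix.PosSemidef.one⟩, fun Z _ => ?_⟩)
  simp [hsInner]

lemma achievableFidelities_subset_gValues {m : ℕ} (hm : 0 < m) :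
    achievableFidelities ρ m ⊆ gValues (rainsSet A B) m ρ := by
  rintro f ⟨Λ, hΛ, rfl⟩
  obtain ⟨W, hW, hWΛ⟩ := exists_adjoint_effect hΛ.1 (isEffect_maxEntangled hm)
  refine (mem_gValues_iff hm).2 ⟨W, ⟨hW, fun Z hZ => ?_⟩, ?_⟩
  · rw [hWΛ]
    exact hsInner_maxEntangled_le (hΛ.2 Z hZ)
  · rw [hsInner_comm, hWΛ, hsInner_comm]

lemma exists_achievableFidelities_ge (hρ : IsState ρ) {m : ℕ} (hm : 0 < m) {g : ℝ}
    (hg : g ∈ gValues (rainsSet A B) m ρ) : ∃ f ∈ achievableFidelities ρ m, g ≤ f := by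
  obtain ⟨W, ⟨hW, hWZ⟩, rfl⟩ := (mem_gValues_iff hm).1 hg
  obtain ⟨Q, hQ, hQR⟩ := exists_state_isotropic_mem_rainsSet hm
  have hm' : (0 : ℝ) < m := by exact_mod_cast hm
  refine ⟨_, ⟨measurePrepare W (maxEntangled m) Q,
    ⟨isCPTP_measurePrepare hW (isState_maxEntangled hm) hQ, fun X hX => ?_⟩, rfl⟩, ?_⟩
  · rw [measurePrepare_apply_of_posSemidef hW hX.1]
    refine hQR _ _ (hsInner_nonneg hW.1 hX.1) (hsInner_nonneg hW.2 hX.1) ?_ ?_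
    · have h := hWZ X hX
      rwa [le_div_iff₀ hm', mul_comm] at h
    · rw [hsInner_comm (1 - W), hsInner_sub_right, hsInner_comm X 1, hsInner_one_left,
        hsInner_comm X W]
      linarith [trace_re_le_one_of_mem_rainsSet hX]
  · rw [measurePrepare_apply_of_posSemidef hW hρ.1, hsInner_comm _ (maxEntangled m),
      hsInner_add_right, hsInner_smul_right, hsInner_smul_right, hsInner_maxEntangled_self hm,
      mul_one, hsInner_comm]
    -- The success branch alone contributes `⟨W, ρ⟩`; the failure branch can only add to it.
    exact le_add_of_nonneg_right (mul_nonneg (hsInner_nonneg hW.2 hρ.1)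
      (hsInner_nonneg (maxEntangled_posSemidef m) hQ.1))

lemma isLUB_achievableFidelities (hρ : IsState ρ) {m : ℕ} (hm : 0 < m) :
    IsLUB (achievableFidelities ρ m) (gQuantity (rainsSet A B) m ρ) := by
  have hG := (isGreatest_gQuantity (ρ := ρ) hm)
  refine ⟨fun f hf => hG.2 (achievableFidelities_subset_gValues hm hf), fun b hb => ?_⟩
  obtain ⟨f, hf, hgf⟩ := exists_achievableFidelities_ge hρ hm hG.1
  exact hgf.trans (hb hf)

lemma distillationFidelity_eq_gQuantity (hρ : IsState ρ) {m : ℕ} (hm : 0 < m) :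
    distillationFidelity ρ m = gQuantity (rainsSet A B) m ρ := by
  have h := isLUB_achievableFidelities hρ hm
  obtain ⟨f, hf, -⟩ := exists_achievableFidelities_ge hρ hm (isGreatest_gQuantity (ρ := ρ) hm).1
  exact h.csSup_eq ⟨f, hf⟩

/-- Minimax for hypothesis tests against the Rains set. -/
lemma exists_minimax_test (hρ : IsState ρ) {ε : ℝ} (hε : 0 ≤ ε) :
    ∃ M₀, (IsEffect M₀ ∧ 1 - hsInner M₀ ρ ≤ ε) ∧ ∃ X₀ ∈ rainsSet A B,
      ∀ M, (IsEffect M ∧ 1 - hsInner M ρ ≤ ε) → ∀ X ∈ rainsSet A B,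
        hsInner M₀ X ≤ hsInner M X₀ := by
  have hset : {M : Matrix (A × B) (A × B) ℂ | IsEffect M ∧ 1 - hsInner M ρ ≤ ε} =
      {M | IsEffect M} ∩ {M | 1 - ε ≤ hsInnerₗ ρ M} := by
    ext M
    simp only [Set.mem_ofPred_eq, Set.mem_inter_iff, hsInnerₗ, LinearMap.coe_mk, AddHom.coe_mk,
      hsInner_comm M ρ]
    exact and_congr_right fun _ => sub_le_comm
  have hconv : Convex ℝ {M : Matrix (A × B) (A × B) ℂ | IsEffect M ∧ 1 - hsInner M ρ ≤ ε} := by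
    rw [hset]
    exact convex_isEffect.inter (convex_halfSpace_ge (hsInnerₗ ρ).isLinear _)
  have hcomp : IsCompact {M : Matrix (A × B) (A × B) ℂ | IsEffect M ∧ 1 - hsInner M ρ ≤ ε} := by
    rw [hset]
    exact isCompact_isEffect.inter_right (isClosed_le continuous_const (continuous_hsInner_right ρ))
  have hne : {M : Matrix (A × B) (A × B) ℂ | IsEffect M ∧ 1 - hsInner M ρ ≤ ε}.Nonempty :=
    ⟨1, isEffect_one, by simpa [hsInner_one_left, hρ.2] using hε⟩
  -- The payoff is linear and continuous in each argument, and both domains are convex, compact and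
  -- nonempty.
  obtain ⟨M₀, hM₀, X₀, hX₀, h⟩ := Sion.exists_isSaddlePointOn (f := fun M X => hsInner M X)
    hne hconv hcomp
    (fun X _ => (continuous_hsInner_left X).lowerSemicontinuous.lowerSemicontinuousOn _)
    (fun X _ => by
      simp only [hsInner_comm _ X]
      exact ((hsInnerₗ X).convexOn hconv).quasiconvexOn)
    (convex_rainsSet (A := A) (B := B)) ⟨0, zero_mem_rainsSet⟩ isCompact_rainsSet
    (fun M _ => (continuous_hsInner_right M).upperSemicontinuous.upperSemicontinuousOn _)
    (fun M _ => ((hsInnerₗ M).concaveOn convex_rainsSet).quasiconcaveOn)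
  exact ⟨M₀, hM₀, X₀, hX₀, h⟩

lemma elog2_mono {x y : ℝ} (h : x ≤ y) : elog2 x ≤ elog2 y := by
  unfold elog2
  split_ifs with h1 h2 h2
  · exact le_rfl
  · exact bot_le
  · exact absurd (h.trans h2) h1
  · exact_mod_cast Real.logb_le_logb_of_le one_lt_two (not_le.1 h1) h

lemma bddBelow_testErrors {ε : ℝ} {X : Matrix (A × B) (A × B) ℂ} (hX : X.PosSemidef) :
    BddBelow {t | ∃ M, IsEffect M ∧ 1 - hsInner M ρ ≤ ε ∧ t = hsInner M X} := by
  refine ⟨0, ?_⟩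
  rintro t ⟨M, hM, -, rfl⟩
  exact hsInner_nonneg hM.1 hX

/-- The value of the minimax problem determines both sides of the one-shot formula. -/
lemma exists_minimax_value (hρ : IsState ρ) {ε : ℝ} (hε : 0 ≤ ε) (hε1 : ε < 1) :
    ∃ v : ℝ, 0 < v ∧ v ≤ 1 ∧
      IsLeast ((fun X => hypothesisTestingEntropy ε ρ X) '' rainsSet A B)
        ((-Real.logb 2 v : ℝ) : EReal) ∧
      ∀ m : ℕ, m ∈ distillableSizes ρ ε ↔ 0 < m ∧ (m : ℝ) * v ≤ 1 := by
  obtain ⟨M₀, hM₀, X₀, hX₀, h⟩ := exists_minimax_test hρ hε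
  have hv0 : 0 < hsInner M₀ X₀ := by
    -- A Rains multiple `c • ρ` forces the value to be at least `c * (1 - ε)`, positive because `ε <
    -- 1`.
    obtain ⟨c, hc, hcρ⟩ := exists_pos_smul_mem_rainsSet hρ.1
    have h1 := h M₀ hM₀ _ hcρ
    rw [hsInner_smul_right] at h1
    exact lt_of_lt_of_le (mul_pos hc (by linarith [hM₀.2])) h1
  have hleast : IsLeast {t | ∃ M, IsEffect M ∧ 1 - hsInner M ρ ≤ ε ∧ t = hsInner M X₀}
      (hsInner M₀ X₀) := by
    refine ⟨⟨M₀, hM₀.1, hM₀.2, rfl⟩, ?_⟩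
    rintro t ⟨M, hM, hMρ, rfl⟩
    exact h M ⟨hM, hMρ⟩ X₀ hX₀
  have helog : elog2 (hsInner M₀ X₀) = ((Real.logb 2 (hsInner M₀ X₀) : ℝ) : EReal) := by
    rw [elog2, if_neg (not_le.2 hv0)]
  refine ⟨hsInner M₀ X₀, hv0, (IsEffect.hsInner_le hM₀.1 hX₀.1).trans (trace_re_le_one_of_mem_rainsSet hX₀),
    ⟨⟨X₀, hX₀, ?_⟩, ?_⟩, fun m => and_congr_right fun hm => ?_⟩
  · simp only [hypothesisTestingEntropy]
    rw [hleast.csInf_eq, helog, EReal.coe_neg]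
  · rintro _ ⟨X, hX, rfl⟩
    rw [EReal.coe_neg, ← helog]
    refine EReal.neg_le_neg_iff.2 (elog2_mono ?_)
    -- Against any other `X`, the test `M₀` already achieves at most the saddle value.
    exact (csInf_le (bddBelow_testErrors hX.1) ⟨M₀, hM₀.1, hM₀.2, rfl⟩).trans (h M₀ hM₀ X hX)
  · have hm' : (0 : ℝ) < m := by exact_mod_cast hm
    have hG := isGreatest_gQuantity (ρ := ρ) hm
    rw [distillationFidelity_eq_gQuantity hρ hm]
    constructor
    -- An optimal `W` for `G` is an admissible test; comparing it with `X₀` bounds the saddle value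
    -- by `1/m`.
    · intro hle
      obtain ⟨W, ⟨hW, hWZ⟩, hWρ⟩ := (mem_gValues_iff hm).1 hG.1
      have h1 := (h W ⟨hW, by rw [hsInner_comm, hWρ]; linarith⟩ X₀ hX₀).trans (hWZ X₀ hX₀)
      rwa [le_div_iff₀ hm', mul_comm] at h1
    -- Conversely `M₀` itself is feasible for `G`.
    · intro hmv
      have h1 : hsInner ρ M₀ ∈ gValues (rainsSet A B) m ρ :=
        (mem_gValues_iff hm).2 ⟨M₀, ⟨hM₀.1, fun Z hZ => (h M₀ hM₀ Z hZ).trans (by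
          rwa [le_div_iff₀ hm', mul_comm])⟩, rfl⟩
      have h2 := hG.2 h1
      rw [hsInner_comm] at h2
      linarith [hM₀.2]

end Distillation

theorem mainTheorem7 {A B : Type*} [Fintype A] [Fintype B] [DecidableEq A] [DecidableEq B]
    (ρ : Matrix (A × B) (A × B) ℂ) (hρ : IsState ρ) :
    (∀ m : ℕ, 0 < m →
      IsLUB (achievableFidelities ρ m) (distillationFidelity ρ m) ∧
      IsLUB (gValues (rainsSet A B) m ρ) (gQuantity (rainsSet A B) m ρ) ∧
      distillationFidelity ρ m = gQuantity (rainsSet A B) m ρ) ∧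
    (∀ ε : ℝ, 0 ≤ ε → ε < 1 →
      IsGreatest (distillableSizes ρ ε) (sSup (distillableSizes ρ ε)) ∧
      ∃ d : ℝ,
        IsLeast ((fun X => hypothesisTestingEntropy ε ρ X) '' rainsSet A B) (d : EReal) ∧
        oneShotDistillable ρ ε = logFloor d) := by
  refine ⟨fun m hm => ?_, fun ε hε hε1 => ?_⟩
  · have h := distillationFidelity_eq_gQuantity hρ hm
    exact ⟨h ▸ isLUB_achievableFidelities hρ hm, (isGreatest_gQuantity hm).isLUB, h⟩
  · obtain ⟨v, hv0, hv1, hleast, hsize⟩ := exists_minimax_value hρ hε hε1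
    have hgr : IsGreatest (distillableSizes ρ ε) ⌊v⁻¹⌋₊ := by
      -- The bound `v ≤ 1` ensures that the floor is at least `1`, an admissible size.
      refine ⟨(hsize _).2 ⟨Nat.floor_pos.2 ((one_le_inv₀ hv0).2 hv1), ?_⟩, fun m hm => ?_⟩
      · rw [← le_inv_mul_iff₀' hv0, mul_one]
        exact Nat.floor_le (inv_pos.2 hv0).le
      · refine Nat.le_floor ?_
        have h := ((hsize m).1 hm).2
        rwa [← le_inv_mul_iff₀' hv0, mul_one] at h
    refine ⟨hgr.csSup_eq.symm ▸ hgr, -Real.logb 2 v, hleast, ?_⟩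
    have hpow : (2 : ℝ) ^ (-Real.logb 2 v) = v⁻¹ := by
      rw [Real.rpow_neg zero_le_two, Real.rpow_logb two_pos (by norm_num) hv0]
    rw [oneShotDistillable, logFloor, hgr.csSup_eq, hpow,
      natCast_floor_eq_intCast_floor (inv_pos.2 hv0).le]
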